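/- \textbf{Theorem (Oracle inequality).} Let $\{\varphi_j\}_{j\in\mathbb N}$ be an orthonormal system of $\mathcal L^2([0,1])$ (of functions defined at every point) for which there is a finite constant $\phi_o$ with $\|\sum_{j=1}^d\varphi_j^2\|_\infty=\sup_{x\in[0,1]}\sum_{j=1}^d\varphi_j(x)^2\le d\phi_o$ for all $d\in\mathbb N=\{1,2,\dots\}$. Let $X_1,\dots,X_n$ ($n\ge1$) be i.i.d. with a square-integrable density $f$ on $[0,1]$, let $t\in[0,1]$, $\alpha\in(0,1)$, and let $\mathcal D\subset\mathbb N$ be a finite set with $|\mathcal D|\le n$ and $n/d\ge\max(\log n,1)$ for all $d\in\mathcal D$. Let $\xi_{i,d}$ ($1\le i\le n$, $d\in\mathcal D$) be i.i.d. standard Laplace variables (Lebesgue density $\tfrac12e^{-|u|}$), independent of $(X_1,\dots,X_n)$. With $g_d(x)=\sum_{j=1}^d\varphi_j(x)\varphi_j(t)$ put $$Z_{i,d}=g_d(X_i)+\frac{2\phi_o d}{\alpha/|\mathcal D|}\,\xi_{i,d},\qquad \hat f_d(t)=\frac1n\sum_{i=1}^nZ_{i,d},\qquad \hat\sigma_d^2=\frac1n\sum_{i=1}^nZ_{i,d}^2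 .$$ Let $c_1=600$, $c_2=432$, $\{x\}_+=\max(x,0)$, and for $d\in\mathcal D$ $$\hat V(d)=\Big(2c_1\frac{\hat\sigma_d^2}{n}+c_2\frac dn\Big)\log n,\qquad \hat A(d)=\max_{D\in\mathcal D,\,D\ge d}\Big\{|\hat f_d(t)-\hat f_D(t)|^2-\big(\hat V(d)+\hat V(D)\big)\Big\}_+ ,$$ and let $\hat d$ be a (measurable) minimiser over $\mathcal D$: $\hat d\in\arg\min_{d\in\mathcal D}\{\hat A(d)+\hat V(d)\}$. Put further $f_d(t)=\sum_{j=1}^d\langle f,\varphi_j\rangle\varphi_j(t)$ and $$\mathrm{bias}^2(d)=\sup_{D\in\mathbb N,\,D\ge d}|f_D(t)-f(t)|^2\in[0,\infty],\qquad V(d)=\Big(c_1\frac{\sigma_d^2}{n}+c_2\frac dn\Big)\log n,\qquad \sigma_d^2=\mathbb E[Z_{1,d}^2].$$ Then there is a constant $C$ depending only on $\phi_o$ such that $$\mathbb E\big(|\hat f_{\hat d}(t)-f(t)|^2\big)\le 16\min_{d\in\mathcal D}\big\{\mathrm{bias}^2(d)+V(d)\big\}+\frac{C\phi_o^2}{n\alpha^2}.$$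 -/

import Mathlib

open MeasureTheory ProbabilityTheory

noncomputable section

namespace PrivProj

/-- The standard Laplace distribution, with Lebesgue density `u ↦ exp (-|u|) / 2` on the line. -/
def laplace : Measure ℝ :=
  volume.withDensity fun u : ℝ => ENNReal.ofReal (Real.exp (-|u|) / 2)

/-- `f` is a square-integrable probability density on `[0,1]`. -/
structure IsSqIntegrableDensity (f : unitInterval → ℝ) : Prop where
  nonneg : ∀ x, 0 ≤ f x
  memLp : MemLp f 2 volume
  integral_eq_one : ∫ x, f x = 1

/-- `(φ j)` is an orthonormal system of (everywhere defined) square-integrable functions on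
`[0,1]`. The enumeration starts at `0`, so `φ 0, …, φ (d - 1)` are the first `d` functions. -/
structure IsOrthonormalSystem (φ : ℕ → unitInterval → ℝ) : Prop where
  memLp : ∀ j, MemLp (φ j) 2 volume
  integral_mul : ∀ j k, ∫ x, φ j x * φ k x = if j = k then 1 else 0

/-- The sup-norm condition `‖∑_{j ≤ d} φ_j²‖_∞ ≤ d φₒ` for all `d ≥ 1`. -/
def SupNormBound (φ : ℕ → unitInterval → ℝ) (φo : ℝ) : Prop :=
  ∀ d : ℕ, 1 ≤ d → ∀ x, ∑ j ∈ Finset.range d, φ j x ^ 2 ≤ d * φo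

/-- `g_d(x) = ∑_{j ≤ d} φ_j(x) φ_j(t)`. -/
def g (φ : ℕ → unitInterval → ℝ) (t : unitInterval) (d : ℕ) (x : unitInterval) : ℝ :=
  ∑ j ∈ Finset.range d, φ j x * φ j t

/-- The projection `f_d(t) = ∑_{j ≤ d} ⟨f, φ_j⟩ φ_j(t)`. -/
def proj (φ : ℕ → unitInterval → ℝ) (f : unitInterval → ℝ) (d : ℕ) (t : unitInterval) : ℝ :=
  ∑ j ∈ Finset.range d, (∫ x, f x * φ j x) * φ j t

/-- The released observation `g_d(x) + (2 φₒ d / α) u`, with raw value `x`, noise value `u` and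
privacy parameter `α`. -/
def privatize (φ : ℕ → unitInterval → ℝ) (t : unitInterval) (φo α : ℝ) (d : ℕ)
    (x : unitInterval) (u : ℝ) : ℝ :=
  g φ t d x + 2 * φo * d / α * u

def c₁ : ℝ := 600

def c₂ : ℝ := 432

section Data

variable {n : ℕ} {Ω : Type*}

/-- The private estimator of the value of the density at the point `t`. -/
def fHat (Z : Fin n → ℕ → Ω → ℝ) (d : ℕ) (ω : Ω) : ℝ :=
  (1 / n) * ∑ i, Z i d ω

def sigmaHatSq (Z : Fin n → ℕ → Ω → ℝ) (d : ℕ) (ω : Ω) : ℝ :=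
  (1 / n) * ∑ i, Z i d ω ^ 2

def VHat (Z : Fin n → ℕ → Ω → ℝ) (d : ℕ) (ω : Ω) : ℝ :=
  (2 * c₁ * (sigmaHatSq Z d ω / n) + c₂ * (d / n)) * Real.log n

/-- The maximum over `D ∈ 𝒟`, `D ≥ d`, of the positive part of
`|f̂_d(t) - f̂_D(t)|² - (V̂(d) + V̂(D))`; `Real.toNNReal` is the positive part. -/
def AHat (𝒟 : Finset ℕ) (Z : Fin n → ℕ → Ω → ℝ) (d : ℕ) (ω : Ω) : ℝ :=
  ((𝒟.filter fun D => d ≤ D).sup fun D =>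
    Real.toNNReal (|fHat Z d ω - fHat Z D ω| ^ 2 - (VHat Z d ω + VHat Z D ω)) : NNReal)

/-- `dHat` is a (measurable) minimiser over `𝒟` of `Â(d) + V̂(d)`. -/
structure IsSelector [MeasurableSpace Ω] (𝒟 : Finset ℕ) (Z : Fin n → ℕ → Ω → ℝ)
    (dHat : Ω → ℕ) : Prop where
  measurable : Measurable dHat
  mem : ∀ ω, dHat ω ∈ 𝒟
  le : ∀ ω, ∀ d ∈ 𝒟, AHat 𝒟 Z (dHat ω) ω + VHat Z (dHat ω) ω ≤ AHat 𝒟 Z d ω + VHat Z d ω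

/-- `σ_d² = E[Z_{1,d}²]`, where `Z_{1,d}` is the observation with first index. -/
def sigmaSq [NeZero n] [MeasurableSpace Ω] (P : Measure Ω) (Z : Fin n → ℕ → Ω → ℝ) (d : ℕ) : ℝ :=
  ∫ ω, Z 0 d ω ^ 2 ∂P

def V [NeZero n] [MeasurableSpace Ω] (P : Measure Ω) (Z : Fin n → ℕ → Ω → ℝ) (d : ℕ) : ℝ :=
  (c₁ * (sigmaSq P Z d / n) + c₂ * (d / n)) * Real.log n

end Data

/-- `bias²(d) = sup_{D ≥ d} |f_D(t) - f(t)|²`, with value in `[0, ∞]` since the projections at the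
point `t` need not be bounded. -/
def biasSq (φ : ℕ → unitInterval → ℝ) (f : unitInterval → ℝ) (t : unitInterval) (d : ℕ) :
    ENNReal :=
  ⨆ D : ℕ, ⨆ _ : d ≤ D, ENNReal.ofReal (|proj φ f D t - f t| ^ 2)

end PrivProj

end

noncomputable section
namespace PrivProj

/-! The argument is a Goldenshluger–Lepski comparison with Bernstein-type control of the noise. With
`b = 2 φo d / (α / |𝒟|)`, Cauchy–Schwarz gives `|g_d| ≤ d φo ≤ b / 2`, so each released value is `b
(M + Ξ)` with `|M| ≤ 1/2` and `Ξ` an independent Laplace variable (`isNoisyMean_privatize`). Every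
probabilistic estimate is then free of the model.

Two random quantities must be small in expectation: the part of `(f̂_d - f_d)²` above `V(d) / 22`
(`IsNoisyMean.deviation`) and the part of `V(d)` above `V̂(d)` (`IsNoisyMean.lower_deviation`). The
first follows from a sub-Gaussian bound on the moment generating function near zero. The second
holds because a nonnegative variable with finite second moment has a sub-Gaussian lower tail; the
factor 2 in front of `σ̂²` leaves room for it. Both are `O(b² / n⁶)`. Since `b ≤ 2 φo n² / α`,
summing over at most `n` dimensions leaves `O(φo² / (n α²))`.

Everything else is pathwise: `sq_error_selector_le` bounds the error of the selected estimator by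
`16 bias²`, multiples of `V̂(d)` and `V(d)`, and the sum of these excesses. Taking expectations and
using `E V̂ ≤ 2 V` gives `8/3 · 2 + 3 ≤ 16` copies of `V(d)`. -/

/-! ### Moments and exponential moments of the Laplace law -/

theorem measurable_laplace_density :
    Measurable fun u : ℝ => ENNReal.ofReal (Real.exp (-|u|) / 2) := by
  fun_prop

theorem integrable_laplace_iff (h : ℝ → ℝ) :
    Integrable h laplace ↔ Integrable (fun u => Real.exp (-|u|) / 2 * h u) volume := by
  rw [laplace, integrable_withDensity_iff_integrable_smul' measurable_laplace_density (by simp)]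
  simp only [smul_eq_mul]
  refine integrable_congr (Filter.Eventually.of_forall fun u => ?_)
  simp only
  rw [ENNReal.toReal_ofReal (by positivity)]

theorem integral_laplace (h : ℝ → ℝ) :
    ∫ u, h u ∂laplace = ∫ u, Real.exp (-|u|) / 2 * h u := by
  rw [laplace, integral_withDensity_eq_integral_toReal_smul measurable_laplace_density (by simp)]
  simp only [smul_eq_mul]
  refine integral_congr_ae (Filter.Eventually.of_forall fun u => ?_)
  simp only
  rw [ENNReal.toReal_ofReal (by positivity)]

theorem integrable_of_integrableOn_Ioi_abs {h : ℝ → ℝ}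
    (hh : IntegrableOn h (Set.Ioi 0)) : Integrable fun u => h |u| := by
  have h1 : IntegrableOn (fun u => h |u|) (Set.Ioi 0) := by
    refine IntegrableOn.congr_fun hh (fun u hu => ?_) measurableSet_Ioi
    rw [abs_of_pos (Set.mem_Ioi.1 hu)]
  have h2 : IntegrableOn (fun u => h |u|) (Set.Iic 0) := by
    rw [← neg_zero] at hh
    rw [integrableOn_Iic_iff_integrableOn_Iio]
    refine IntegrableOn.congr_fun hh.comp_neg_Iio (fun u hu => ?_) measurableSet_Iio
    rw [abs_of_neg (Set.mem_Iio.1 hu)]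
  rw [← integrableOn_univ, ← Set.Iic_union_Ioi (a := (0 : ℝ))]
  exact h2.union h1

theorem integrableOn_exp_mul_pow (k : ℕ) :
    IntegrableOn (fun u : ℝ => Real.exp (-u) / 2 * u ^ k) (Set.Ioi 0) := by
  have h := (Real.GammaIntegral_convergent (s := k + 1) (by positivity)).div_const 2
  refine IntegrableOn.congr_fun h (fun u hu => ?_) measurableSet_Ioi
  simp only [add_sub_cancel_right, Real.rpow_natCast]
  ring

theorem integrable_abs_pow_laplace (k : ℕ) : Integrable (fun u : ℝ => |u| ^ k) laplace := by
  rw [integrable_laplace_iff]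
  exact integrable_of_integrableOn_Ioi_abs (integrableOn_exp_mul_pow k)

theorem integral_abs_pow_laplace (k : ℕ) : ∫ u : ℝ, |u| ^ k ∂laplace = k.factorial := by
  rw [integral_laplace,
    integral_comp_abs (f := fun u : ℝ => Real.exp (-u) / 2 * u ^ k),
    ← Real.Gamma_nat_eq_factorial, Real.Gamma_eq_integral (by positivity),
    ← integral_const_mul]
  refine setIntegral_congr_fun measurableSet_Ioi fun u hu => ?_
  simp only [add_sub_cancel_right, Real.rpow_natCast]
  ring

instance : IsProbabilityMeasure laplace := by
  constructor
  have h := integral_abs_pow_laplace 0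
  simp only [pow_zero, integral_const, smul_eq_mul, mul_one, Nat.factorial_zero, Nat.cast_one,
    Measure.real] at h
  exact (ENNReal.toReal_eq_one_iff _).1 h

theorem integrable_pow_laplace (k : ℕ) : Integrable (fun u : ℝ => u ^ k) laplace :=
  (integrable_abs_pow_laplace k).mono' (by fun_prop)
    (Filter.Eventually.of_forall fun u => by simp)

theorem integral_sq_laplace : ∫ u : ℝ, u ^ 2 ∂laplace = 2 := by
  have h := integral_abs_pow_laplace 2
  simpa using h

theorem integral_pow_four_laplace : ∫ u : ℝ, u ^ 4 ∂laplace = 24 := by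
  have h := integral_abs_pow_laplace 4
  simp only [(by decide : Even 4).pow_abs] at h
  rw [h]
  norm_num [Nat.factorial]

theorem integral_id_laplace : ∫ u : ℝ, u ∂laplace = 0 := by
  rw [integral_laplace]
  have h := integral_neg_eq_self (fun u : ℝ => Real.exp (-|u|) / 2 * u) volume
  simp only [abs_neg, mul_neg, integral_neg] at h
  linarith

theorem integrable_exp_mul_laplace {s : ℝ} (hs : |s| < 1) :
    Integrable (fun u => Real.exp (s * u)) laplace := by
  have hs' := abs_lt.1 hs
  rw [integrable_laplace_iff, ← integrableOn_univ, ← Set.Iic_union_Ioi (a := (0 : ℝ))]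
  refine IntegrableOn.union ?_ ?_
  · refine IntegrableOn.congr_fun
      ((integrableOn_exp_mul_Iic (a := 1 + s) (by linarith) 0).div_const 2)
      (fun u hu => ?_) measurableSet_Iic
    rw [abs_of_nonpos (Set.mem_Iic.1 hu), div_mul_eq_mul_div, ← Real.exp_add]
    ring_nf
  · refine IntegrableOn.congr_fun
      ((integrableOn_exp_mul_Ioi (a := s - 1) (by linarith) 0).div_const 2)
      (fun u hu => ?_) measurableSet_Ioi
    rw [abs_of_pos (Set.mem_Ioi.1 hu), div_mul_eq_mul_div, ← Real.exp_add]
    ring_nf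

/-- The moment generating function of the Laplace distribution is `s ↦ 1 / (1 - s²)`. -/
theorem integral_exp_mul_laplace {s : ℝ} (hs : |s| < 1) :
    ∫ u, Real.exp (s * u) ∂laplace = 1 / (1 - s ^ 2) := by
  have hs' := abs_lt.1 hs
  have hI := (integrable_laplace_iff _).1 (integrable_exp_mul_laplace hs)
  rw [integral_laplace, ← intervalIntegral.integral_Iic_add_Ioi (b := (0 : ℝ)) hI.integrableOn
    hI.integrableOn]
  have h1 : ∫ u in Set.Iic (0 : ℝ), Real.exp (-|u|) / 2 * Real.exp (s * u)
      = (∫ u in Set.Iic (0 : ℝ), Real.exp ((1 + s) * u)) / 2 := by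
    rw [← integral_div]
    refine setIntegral_congr_fun measurableSet_Iic fun u hu => ?_
    rw [abs_of_nonpos (Set.mem_Iic.1 hu), div_mul_eq_mul_div, ← Real.exp_add]
    ring_nf
  have h2 : ∫ u in Set.Ioi (0 : ℝ), Real.exp (-|u|) / 2 * Real.exp (s * u)
      = (∫ u in Set.Ioi (0 : ℝ), Real.exp ((s - 1) * u)) / 2 := by
    rw [← integral_div]
    refine setIntegral_congr_fun measurableSet_Ioi fun u hu => ?_
    rw [abs_of_pos (Set.mem_Ioi.1 hu), div_mul_eq_mul_div, ← Real.exp_add]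
    ring_nf
  rw [h1, h2, integral_exp_mul_Iic (by linarith), integral_exp_mul_Ioi (by linarith)]
  have e1 : 1 + s ≠ 0 := by linarith
  have e2 : s - 1 ≠ 0 := by linarith
  have e3 : 1 - s ^ 2 ≠ 0 := by
    have : 1 - s ^ 2 = -((1 + s) * (s - 1)) := by ring
    rw [this]
    exact neg_ne_zero.2 (mul_ne_zero e1 e2)
  simp only [mul_zero, Real.exp_zero]
  field_simp
  ring

/-- With `u = s²`, this is `1 ≤ (1 - u) exp (2u)`; the quadratic Taylor bound for `exp (2u)` reduces
it to `1 ≤ 1 + u (1 - 2u²)`. -/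
theorem integral_exp_mul_laplace_le {s : ℝ} (hs : s ^ 2 ≤ 1 / 2) :
    ∫ u, Real.exp (s * u) ∂laplace ≤ Real.exp (2 * s ^ 2) := by
  have hs1 : |s| < 1 := by
    rw [abs_lt]
    constructor <;> nlinarith
  rw [integral_exp_mul_laplace hs1, div_le_iff₀ (by linarith)]
  have h := Real.quadratic_le_exp_of_nonneg (x := 2 * s ^ 2) (by positivity)
  have h0 : 0 ≤ s ^ 2 := sq_nonneg s
  set u := s ^ 2
  have h4 : (1 + 2 * u + (2 * u) ^ 2 / 2) * (1 - u) ≤ Real.exp (2 * u) * (1 - u) :=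
    mul_le_mul_of_nonneg_right h (by linarith)
  have h5 : 0 ≤ u * (1 - 2 * u ^ 2) := mul_nonneg h0 (by nlinarith)
  nlinarith

/-! ### Independence of pairs -/

section Independence

variable {Ω ι α β : Type*} [MeasurableSpace Ω] [MeasurableSpace α] [MeasurableSpace β] [Fintype ι]
  {P : Measure Ω} {X : ι → Ω → α} {Y : ι → Ω → β}

/-- If the families `X` and `Y` are each independent, and independent of one another, then the
pairs `(X i, Y i)` are independent. -/
theorem iIndepFun_prodMk_of_indepFun [IsProbabilityMeasure P] (mX : ∀ i, Measurable (X i))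
    (mY : ∀ i, Measurable (Y i)) (hX : iIndepFun X P) (hY : iIndepFun Y P)
    (hXY : IndepFun (fun ω i => X i ω) (fun ω i => Y i ω) P) :
    iIndepFun (fun i ω => (X i ω, Y i ω)) P := by
  have hpX : ∀ i, IsProbabilityMeasure (P.map (X i)) :=
    fun i => Measure.isProbabilityMeasure_map (mX i).aemeasurable
  have hpY : ∀ i, IsProbabilityMeasure (P.map (Y i)) :=
    fun i => Measure.isProbabilityMeasure_map (mY i).aemeasurable
  have hpair : ∀ i, P.map (fun ω => (X i ω, Y i ω)) = (P.map (X i)).prod (P.map (Y i)) := fun i =>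
    (indepFun_iff_map_prod_eq_prod_map_map (mX i).aemeasurable (mY i).aemeasurable).1
      (hXY.comp (measurable_pi_apply i) (measurable_pi_apply i))
  rw [iIndepFun_iff_map_fun_eq_pi_map fun i => ((mX i).prodMk (mY i)).aemeasurable]
  simp only [hpair]
  -- A family of pairs is regrouped as a pair of families; there the joint law is the product of two
  -- product measures, by the three independence hypotheses.
  rw [← (MeasurableEquiv.arrowProdEquivProdArrow α β ι).map_measurableEquiv_injective.eq_iff,
    (measurePreserving_arrowProdEquivProdArrow α β ι (fun i => P.map (X i))
      fun i => P.map (Y i)).map_eq, Measure.map_map (MeasurableEquiv.measurable _) (by fun_prop),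
    ← hX.map_fun_eq_pi_map fun i => (mX i).aemeasurable,
    ← hY.map_fun_eq_pi_map fun i => (mY i).aemeasurable,
    ← (indepFun_iff_map_prod_eq_prod_map_map (by fun_prop) (by fun_prop)).1 hXY]
  rfl

end Independence

/-! ### One bounded variable plus Laplace noise -/

section Single

variable {Ω : Type*} [MeasurableSpace Ω] {P : Measure Ω} {M Ξ : Ω → ℝ}

theorem integrable_comp_of_map_eq_laplace (mΞ : Measurable Ξ) (hΞ : P.map Ξ = laplace)
    {h : ℝ → ℝ} (hh : Integrable h laplace) : Integrable (fun ω => h (Ξ ω)) P := by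
  rw [← hΞ] at hh
  exact hh.comp_measurable mΞ

theorem integral_comp_of_map_eq_laplace (mΞ : Measurable Ξ) (hΞ : P.map Ξ = laplace)
    {h : ℝ → ℝ} (hh : Measurable h) : ∫ ω, h (Ξ ω) ∂P = ∫ u, h u ∂laplace := by
  rw [← hΞ, integral_map mΞ.aemeasurable hh.aestronglyMeasurable]

variable [IsProbabilityMeasure P]

theorem integrable_of_abs_le {r : ℝ} (mM : AEMeasurable M P) (hM : ∀ ω, |M ω| ≤ r) :
    Integrable M P :=
  Integrable.of_bound mM.aestronglyMeasurable r (Filter.Eventually.of_forall hM)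

theorem sq_le_of_abs_le_half {x : ℝ} (hx : |x| ≤ 1 / 2) : x ^ 2 ≤ 1 / 4 := by
  have := abs_le.1 hx
  nlinarith

theorem integrable_sq_of_abs_le_half (mM : AEMeasurable M P) (hM : ∀ ω, |M ω| ≤ 1 / 2) :
    Integrable (fun ω => M ω ^ 2) P :=
  integrable_of_abs_le (r := 1 / 4) (mM.pow_const 2) fun ω => by
    rw [abs_of_nonneg (sq_nonneg _)]
    exact sq_le_of_abs_le_half (hM ω)

theorem integrable_add_laplace_sq (mM : AEMeasurable M P) (hM : ∀ ω, |M ω| ≤ 1 / 2)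
    (mΞ : Measurable Ξ) (hΞ : P.map Ξ = laplace) (hI : IndepFun M Ξ P) :
    Integrable (fun ω => (M ω + Ξ ω) ^ 2) P := by
  have h1 := integrable_sq_of_abs_le_half mM hM
  have h2 := integrable_comp_of_map_eq_laplace mΞ hΞ (integrable_pow_laplace 2)
  have h3 := hI.integrable_mul (integrable_of_abs_le mM hM)
    (integrable_comp_of_map_eq_laplace mΞ hΞ (by simpa using integrable_pow_laplace 1))
  refine ((h1.add (h3.const_mul 2)).add h2).congr (Filter.Eventually.of_forall fun ω => ?_)
  simp only [Pi.add_apply, Pi.mul_apply]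
  ring

theorem integral_add_laplace_sq (mM : AEMeasurable M P) (hM : ∀ ω, |M ω| ≤ 1 / 2)
    (mΞ : Measurable Ξ) (hΞ : P.map Ξ = laplace) (hI : IndepFun M Ξ P) :
    ∫ ω, (M ω + Ξ ω) ^ 2 ∂P = ∫ ω, M ω ^ 2 ∂P + 2 := by
  have h1 := integrable_sq_of_abs_le_half mM hM
  have h2 := integrable_comp_of_map_eq_laplace mΞ hΞ (integrable_pow_laplace 2)
  have h3 : Integrable (fun ω => M ω * Ξ ω) P := hI.integrable_mul (integrable_of_abs_le mM hM)
    (integrable_comp_of_map_eq_laplace mΞ hΞ (by simpa using integrable_pow_laplace 1))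
  have h4 : ∫ ω, M ω * Ξ ω ∂P = 0 := by
    have h5 := hI.integral_mul_eq_mul_integral mM.aestronglyMeasurable mΞ.aestronglyMeasurable
    have h6 := integral_comp_of_map_eq_laplace mΞ hΞ measurable_id
    simp only [id_eq, integral_id_laplace] at h6
    rw [h6, mul_zero] at h5
    exact h5
  have h7 : ∀ ω, (M ω + Ξ ω) ^ 2 = M ω ^ 2 + 2 * (M ω * Ξ ω) + Ξ ω ^ 2 := fun ω => by ring
  have h8 : Integrable (fun ω => M ω ^ 2 + 2 * (M ω * Ξ ω)) P := h1.add (h3.const_mul 2)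
  simp only [h7]
  rw [integral_add h8 h2, integral_add h1 (h3.const_mul 2),
    integral_const_mul, h4,
    integral_comp_of_map_eq_laplace mΞ hΞ (h := fun u => u ^ 2) (by fun_prop), integral_sq_laplace]
  ring

theorem two_le_integral_add_laplace_sq (mM : AEMeasurable M P) (hM : ∀ ω, |M ω| ≤ 1 / 2)
    (mΞ : Measurable Ξ) (hΞ : P.map Ξ = laplace) (hI : IndepFun M Ξ P) :
    2 ≤ ∫ ω, (M ω + Ξ ω) ^ 2 ∂P := by
  rw [integral_add_laplace_sq mM hM mΞ hΞ hI]
  have : 0 ≤ ∫ ω, M ω ^ 2 ∂P := integral_nonneg fun ω => sq_nonneg _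
  linarith

theorem integral_add_laplace_sq_le (mM : AEMeasurable M P) (hM : ∀ ω, |M ω| ≤ 1 / 2)
    (mΞ : Measurable Ξ) (hΞ : P.map Ξ = laplace) (hI : IndepFun M Ξ P) :
    ∫ ω, (M ω + Ξ ω) ^ 2 ∂P ≤ 9 / 4 := by
  rw [integral_add_laplace_sq mM hM mΞ hΞ hI]
  have : ∫ ω, M ω ^ 2 ∂P ≤ ∫ _, (1 / 4 : ℝ) ∂P :=
    integral_mono (integrable_sq_of_abs_le_half mM hM) (integrable_const _)
      fun ω => sq_le_of_abs_le_half (hM ω)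
  simp only [integral_const, probReal_univ, smul_eq_mul, one_mul] at this
  linarith

theorem add_pow_four_le {x u : ℝ} (hx : |x| ≤ 1 / 2) : (x + u) ^ 4 ≤ 1 / 2 + 8 * u ^ 4 := by
  have h1 := sq_le_of_abs_le_half hx
  have h2 : (x + u) ^ 2 ≤ 2 * x ^ 2 + 2 * u ^ 2 := by nlinarith [sq_nonneg (x - u)]
  have h3 : (x + u) ^ 2 ≤ 1 / 2 + 2 * u ^ 2 := by linarith
  have h4 : ((x + u) ^ 2) ^ 2 ≤ (1 / 2 + 2 * u ^ 2) ^ 2 := by gcongr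
  nlinarith [sq_nonneg (1 / 2 - 2 * u ^ 2)]

/-- Multiply by `exp v ≥ 1 + v + v² / 2`: the product of the two quadratics is `1 + v⁴ / 4`. -/
theorem exp_neg_le_quadratic {v : ℝ} (hv : 0 ≤ v) : Real.exp (-v) ≤ 1 - v + v ^ 2 / 2 := by
  have h := Real.quadratic_le_exp_of_nonneg hv
  rw [Real.exp_neg, inv_le_iff_one_le_mul₀ (Real.exp_pos v)]
  have h2 : 0 < 1 - v + v ^ 2 / 2 := by nlinarith [sq_nonneg (v - 1)]
  have h3 : (1 - v + v ^ 2 / 2) * (1 + v + v ^ 2 / 2) ≤ (1 - v + v ^ 2 / 2) * Real.exp v := by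
    gcongr
  nlinarith [sq_nonneg (v ^ 2)]

/-- For a nonnegative variable the Laplace transform at negative arguments needs only two moments.
The fourth moment of `M + Ξ` is at most `1/2 + 8 · 24 = 385/2`, rounded up to `193`. -/
theorem integral_exp_neg_add_laplace_sq_le (mM : AEMeasurable M P) (hM : ∀ ω, |M ω| ≤ 1 / 2)
    (mΞ : Measurable Ξ) (hΞ : P.map Ξ = laplace) (hI : IndepFun M Ξ P) {τ : ℝ} (hτ : 0 ≤ τ) :
    ∫ ω, Real.exp (-τ * (M ω + Ξ ω) ^ 2) ∂P ≤
      Real.exp (-τ * ∫ ω, (M ω + Ξ ω) ^ 2 ∂P + 193 / 2 * τ ^ 2) := by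
  have h1 := integrable_add_laplace_sq mM hM mΞ hΞ hI
  have h2 := integrable_comp_of_map_eq_laplace mΞ hΞ (integrable_pow_laplace 4)
  have hle : ∀ ω, Real.exp (-τ * (M ω + Ξ ω) ^ 2) ≤
      1 + (-τ) * (M ω + Ξ ω) ^ 2 + τ ^ 2 / 2 * (1 / 2 + 8 * Ξ ω ^ 4) := fun ω => by
    have h3 := exp_neg_le_quadratic (v := τ * (M ω + Ξ ω) ^ 2) (by positivity)
    have h4 := mul_le_mul_of_nonneg_left (add_pow_four_le (u := Ξ ω) (hM ω))
      (by positivity : 0 ≤ τ ^ 2 / 2)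
    rw [neg_mul]
    refine h3.trans (le_trans (le_of_eq ?_) (add_le_add_right h4 _))
    ring
  have hi0 : Integrable (fun ω => 1 + (-τ) * (M ω + Ξ ω) ^ 2) P :=
    (integrable_const _).add (h1.const_mul _)
  have hi1 : Integrable (fun ω => 1 / 2 + 8 * Ξ ω ^ 4) P :=
    (integrable_const _).add (h2.const_mul _)
  have hmono := integral_mono_of_nonneg (Filter.Eventually.of_forall fun ω => (Real.exp_pos _).le)
    (hi0.add (hi1.const_mul (τ ^ 2 / 2))) (Filter.Eventually.of_forall hle)
  refine hmono.trans ?_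
  simp only [Pi.add_apply]
  rw [integral_add hi0 (hi1.const_mul _), integral_const_mul, integral_add (integrable_const _)
    (h1.const_mul _), integral_add (integrable_const _) (h2.const_mul _), integral_const_mul,
    integral_const_mul, integral_comp_of_map_eq_laplace mΞ hΞ (h := fun u => u ^ 4) (by fun_prop),
    integral_pow_four_laplace]
  simp only [integral_const, probReal_univ, smul_eq_mul, one_mul]
  refine le_trans ?_ (Real.add_one_le_exp _)
  nlinarith [sq_nonneg τ]

/-- A variable with values in `[-1/2, 1/2]` plus independent Laplace noise, once centred, is
sub-Gaussian for small arguments. -/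
theorem mgf_add_laplace_sub_le (mM : AEMeasurable M P) (hM : ∀ ω, |M ω| ≤ 1 / 2)
    (mΞ : Measurable Ξ) (hΞ : P.map Ξ = laplace) (hI : IndepFun M Ξ P) {s : ℝ}
    (hs : s ^ 2 ≤ 1 / 2) :
    mgf (fun ω => M ω + Ξ ω - ∫ ω, M ω ∂P) P s ≤ Real.exp (17 / 8 * s ^ 2) := by
  have hsub := (hasSubgaussianMGF_of_mem_Icc (a := -(1 / 2)) (b := 1 / 2) mM
    (Filter.Eventually.of_forall fun ω => abs_le.1 (hM ω))).mgf_le s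
  have hI' : IndepFun (fun ω => M ω - ∫ ω, M ω ∂P) Ξ P :=
    hI.comp (measurable_id.sub_const (∫ ω, M ω ∂P)) measurable_id
  have heq : (fun ω => M ω + Ξ ω - ∫ ω, M ω ∂P) = (fun ω => M ω - ∫ ω, M ω ∂P) + Ξ := by
    ext ω
    simp only [Pi.add_apply]
    ring
  rw [heq, hI'.mgf_add' (mM.sub_const _).aestronglyMeasurable mΞ.aestronglyMeasurable]
  have h2 : mgf Ξ P s ≤ Real.exp (2 * s ^ 2) := by
    rw [mgf, integral_comp_of_map_eq_laplace mΞ hΞ (h := fun u => Real.exp (s * u)) (by fun_prop)]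
    exact integral_exp_mul_laplace_le hs
  -- The share `1/8` is Hoeffding's lemma on an interval of length one; the share `2` is the Laplace
  -- noise.
  have hsplit : Real.exp (17 / 8 * s ^ 2) = Real.exp (1 / 8 * s ^ 2) * Real.exp (2 * s ^ 2) := by
    rw [← Real.exp_add]
    ring_nf
  rw [hsplit]
  refine mul_le_mul (hsub.trans (le_of_eq ?_)) h2 mgf_nonneg (Real.exp_pos _).le
  congr 1
  norm_num
  ring

theorem integrable_exp_add_laplace (mM : AEMeasurable M P) (hM : ∀ ω, |M ω| ≤ 1 / 2)
    (mΞ : Measurable Ξ) (hΞ : P.map Ξ = laplace) (hI : IndepFun M Ξ P) {s : ℝ}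
    (hs : s ^ 2 ≤ 1 / 2) (c : ℝ) :
    Integrable (fun ω => Real.exp (s * (M ω + Ξ ω - c))) P := by
  have h1 := integrable_exp_mul_of_mem_Icc (t := s) mM
    (Filter.Eventually.of_forall fun ω => abs_le.1 (hM ω))
  have h2 := integrable_comp_of_map_eq_laplace mΞ hΞ (integrable_exp_mul_laplace (s := s)
    (abs_lt.2 ⟨by nlinarith, by nlinarith⟩))
  refine ((hI.integrable_exp_mul_add h1 h2).mul_const (Real.exp (-(s * c)))).congr
    (Filter.Eventually.of_forall fun ω => ?_)
  simp only [Pi.add_apply]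
  rw [← Real.exp_add]
  ring_nf

end Single

/-! ### Chernoff bounds for independent sums -/

section Sums

variable {Ω ι : Type*} [MeasurableSpace Ω] [Fintype ι] {P : Measure Ω} {W : ι → Ω → ℝ}

theorem integrable_exp_mul_sum_of_iIndepFun (hW : iIndepFun W P) (mW : ∀ i, AEMeasurable (W i) P)
    {s : ℝ} (hI : ∀ i, Integrable (fun ω => Real.exp (s * W i ω)) P) :
    Integrable (fun ω => Real.exp (s * ∑ i, W i ω)) P := by
  have := hW.isProbabilityMeasure
  have h := hW.mgf_sum₀ (t := s) mW Finset.univ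
  have hpos : 0 < ∏ i, mgf (W i) P s := Finset.prod_pos fun i _ => mgf_pos (hI i)
  rw [← h] at hpos
  -- A non-integrable function would have Bochner integral zero, contradicting the positive product
  -- of the factors.
  have h2 : Integrable (fun ω => Real.exp (s * (∑ i, W i) ω)) P := by
    by_contra hc
    rw [mgf, integral_undef hc] at hpos
    exact lt_irrefl _ hpos
  simpa only [Finset.sum_apply] using h2

theorem integral_exp_mul_sum_le_pow (hW : iIndepFun W P) (mW : ∀ i, AEMeasurable (W i) P)
    {s r : ℝ} (hr : ∀ i, mgf (W i) P s ≤ r) :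
    ∫ ω, Real.exp (s * ∑ i, W i ω) ∂P ≤ r ^ Fintype.card ι := by
  have h := hW.mgf_sum₀ (t := s) mW Finset.univ
  simp only [mgf, Finset.sum_apply] at h
  rw [h]
  refine (Finset.prod_le_prod (fun i _ => mgf_nonneg) fun i _ => hr i).trans ?_
  simp

/-- For `z = |y| > x`, write `z² - x² = 2x (z - x) + (z - x)²` and bound `w` and `w² / 2` by `exp w`
at `w = s (z - x)`. The two exponentials cover both signs of `y`, so the truncated square is
controlled by moment generating functions alone. -/
theorem max_sq_sub_sq_le {x y s : ℝ} (hx : 0 ≤ x) (hs : 0 < s) :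
    max (y ^ 2 - x ^ 2) 0 ≤ (2 * x / s + 2 / s ^ 2) *
      (Real.exp (s * y) * Real.exp (-(s * x)) + Real.exp (-s * y) * Real.exp (-(s * x))) := by
  have key : ∀ z : ℝ, 0 ≤ z → x ≤ z → z ^ 2 - x ^ 2 ≤
      (2 * x / s + 2 / s ^ 2) * Real.exp (s * (z - x)) := fun z hz hxz => by
    have h0 : 0 ≤ s * (z - x) := mul_nonneg hs.le (by linarith)
    have h1 := Real.quadratic_le_exp_of_nonneg h0
    have h2 : s * (z - x) ≤ Real.exp (s * (z - x)) := by nlinarith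
    have h3 : (s * (z - x)) ^ 2 ≤ 2 * Real.exp (s * (z - x)) := by nlinarith
    have h4 := mul_le_mul_of_nonneg_left h2 (by positivity : 0 ≤ 2 * x / s)
    have h5 := mul_le_mul_of_nonneg_left h3 (by positivity : 0 ≤ 1 / s ^ 2)
    have h6 : z ^ 2 - x ^ 2 = 2 * x / s * (s * (z - x)) + 1 / s ^ 2 * (s * (z - x)) ^ 2 := by
      field_simp
      ring
    rw [h6, add_mul]
    refine add_le_add h4 (h5.trans (le_of_eq ?_))
    ring
  refine max_le ?_ (by positivity)
  rw [← Real.exp_add, ← Real.exp_add]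
  have hc : 0 ≤ 2 * x / s + 2 / s ^ 2 := by positivity
  rcases le_or_gt |y| x with hyx | hyx
  · have : y ^ 2 ≤ x ^ 2 := sq_le_sq' (abs_le.1 hyx).1 (abs_le.1 hyx).2
    have h0 : 0 ≤ (2 * x / s + 2 / s ^ 2) *
      (Real.exp (s * y + -(s * x)) + Real.exp (-s * y + -(s * x))) := by positivity
    linarith
  · have h1 := key |y| (abs_nonneg y) hyx.le
    rw [sq_abs] at h1
    refine h1.trans (mul_le_mul_of_nonneg_left ?_ hc)
    rcases abs_cases y with ⟨h, -⟩ | ⟨h, -⟩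
    · rw [h, show s * (y - x) = s * y + -(s * x) by ring]
      linarith [Real.exp_pos (-s * y + -(s * x))]
    · rw [h, show s * (-y - x) = -s * y + -(s * x) by ring]
      linarith [Real.exp_pos (s * y + -(s * x))]

/-- Truncated second moment of a sum of independent variables with sub-Gaussian moment generating
function at the arguments `±s`. -/
theorem integral_max_sum_sq_sub_le (hW : iIndepFun W P) (mW : ∀ i, AEMeasurable (W i) P)
    {s x v : ℝ} (hs : 0 < s) (hx : 0 ≤ x)
    (hI : ∀ i, Integrable (fun ω => Real.exp (s * W i ω)) P)
    (hI' : ∀ i, Integrable (fun ω => Real.exp (-s * W i ω)) P)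
    (hr : ∀ i, mgf (W i) P s ≤ Real.exp v) (hr' : ∀ i, mgf (W i) P (-s) ≤ Real.exp v) :
    Integrable (fun ω => max ((∑ i, W i ω) ^ 2 - x ^ 2) 0) P ∧
    ∫ ω, max ((∑ i, W i ω) ^ 2 - x ^ 2) 0 ∂P ≤
      (2 * x / s + 2 / s ^ 2) * (2 * Real.exp (Fintype.card ι * v - s * x)) := by
  have i1 := (integrable_exp_mul_sum_of_iIndepFun hW mW hI).mul_const (Real.exp (-(s * x)))
  have i2 := (integrable_exp_mul_sum_of_iIndepFun hW mW hI').mul_const (Real.exp (-(s * x)))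
  have hle : ∀ ω, max ((∑ i, W i ω) ^ 2 - x ^ 2) 0 ≤ (2 * x / s + 2 / s ^ 2) *
      (Real.exp (s * ∑ i, W i ω) * Real.exp (-(s * x)) +
        Real.exp (-s * ∑ i, W i ω) * Real.exp (-(s * x))) := fun ω => max_sq_sub_sq_le hx hs
  have mS : AEMeasurable (fun ω => ∑ i, W i ω) P :=
    Finset.aemeasurable_fun_sum _ fun i _ => mW i
  have hint : Integrable (fun ω => max ((∑ i, W i ω) ^ 2 - x ^ 2) 0) P := by
    refine ((i1.add i2).const_mul (2 * x / s + 2 / s ^ 2)).mono'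
      (((mS.pow_const 2).sub_const _).max aemeasurable_const).aestronglyMeasurable
      (Filter.Eventually.of_forall fun ω => ?_)
    rw [Real.norm_of_nonneg (le_max_right _ _)]
    exact hle ω
  refine ⟨hint, (integral_mono hint ((i1.add i2).const_mul _) hle).trans ?_⟩
  simp only [Pi.add_apply]
  rw [integral_const_mul, integral_add i1 i2, integral_mul_const, integral_mul_const]
  refine mul_le_mul_of_nonneg_left ?_ (by positivity)
  have h1 := mul_le_mul_of_nonneg_right (integral_exp_mul_sum_le_pow hW mW hr)
    (Real.exp_pos (-(s * x))).le
  have h2 := mul_le_mul_of_nonneg_right (integral_exp_mul_sum_le_pow hW mW hr')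
    (Real.exp_pos (-(s * x))).le
  rw [← Real.exp_nat_mul, ← Real.exp_add, ← sub_eq_add_neg] at h1 h2
  linarith

/-- Lower deviations of an empirical second moment. -/
theorem integral_max_sub_sum_sq_le [Nonempty ι] (hW : iIndepFun W P)
    (mW : ∀ i, AEMeasurable (W i) P) {σ τ v : ℝ} (hσ : 0 ≤ σ) (hτ : 0 ≤ τ)
    (hr : ∀ i, ∫ ω, Real.exp (-τ * W i ω ^ 2) ∂P ≤ Real.exp (-(τ * σ) / 2 - v)) :
    Integrable (fun ω => max (σ - 2 * ((∑ i, W i ω ^ 2) / Fintype.card ι)) 0) P ∧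
    ∫ ω, max (σ - 2 * ((∑ i, W i ω ^ 2) / Fintype.card ι)) 0 ∂P ≤
      σ * Real.exp (-(Fintype.card ι * v)) := by
  have := hW.isProbabilityMeasure
  have hn : (0 : ℝ) < Fintype.card ι := by exact_mod_cast Fintype.card_pos
  set n : ℝ := (Fintype.card ι : ℝ) with hnd
  have hW2 : iIndepFun (fun i ω => W i ω ^ 2) P := hW.comp (fun _ u => u ^ 2) fun _ => by fun_prop
  have mW2 : ∀ i, AEMeasurable (fun ω => W i ω ^ 2) P := fun i => (mW i).pow_const 2
  have hI : ∀ i, Integrable (fun ω => Real.exp (-τ * W i ω ^ 2)) P := fun i =>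
    Integrable.of_bound (((mW2 i).const_mul _).exp.aestronglyMeasurable) 1
      (Filter.Eventually.of_forall fun ω => by
        rw [Real.norm_of_nonneg (Real.exp_pos _).le, Real.exp_le_one_iff, neg_mul]
        exact neg_nonpos.2 (by positivity))
  have i1 := integrable_exp_mul_sum_of_iIndepFun hW2 mW2 hI
  -- The positive part is at most `σ` and vanishes unless `∑ W² < nσ / 2`, where the exponential of
  -- `τ (nσ / 2 - ∑ W²)` is at least one.
  have hle : ∀ ω, max (σ - 2 * ((∑ i, W i ω ^ 2) / n)) 0 ≤
      σ * (Real.exp (n * (τ * σ / 2)) * Real.exp (-τ * ∑ i, W i ω ^ 2)) := fun ω => by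
    have hS : 0 ≤ ∑ i, W i ω ^ 2 := Finset.sum_nonneg fun i _ => sq_nonneg _
    refine max_le ?_ (by positivity)
    rcases le_or_gt σ (2 * ((∑ i, W i ω ^ 2) / n)) with h | h
    · have : 0 ≤ σ * (Real.exp (n * (τ * σ / 2)) * Real.exp (-τ * ∑ i, W i ω ^ 2)) := by
        positivity
      linarith
    · have h1 : 2 * ∑ i, W i ω ^ 2 ≤ n * σ := by
        rw [mul_div_assoc', div_lt_iff₀ hn] at h
        linarith
      have h2 : 1 ≤ Real.exp (n * (τ * σ / 2)) * Real.exp (-τ * ∑ i, W i ω ^ 2) := by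
        rw [← Real.exp_add, Real.one_le_exp_iff]
        nlinarith
      have h3 : 0 ≤ (∑ i, W i ω ^ 2) / n := by positivity
      nlinarith
  have mS : AEMeasurable (fun ω => ∑ i, W i ω ^ 2) P :=
    Finset.aemeasurable_fun_sum _ fun i _ => mW2 i
  have hint : Integrable (fun ω => max (σ - 2 * ((∑ i, W i ω ^ 2) / n)) 0) P := by
    refine ((i1.const_mul (Real.exp (n * (τ * σ / 2)))).const_mul σ).mono'
      ((((mS.div_const n).const_mul 2).const_sub σ).max aemeasurable_const).aestronglyMeasurable
      (Filter.Eventually.of_forall fun ω => ?_)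
    rw [Real.norm_of_nonneg (le_max_right _ _)]
    exact hle ω
  refine ⟨hint, (integral_mono hint ((i1.const_mul _).const_mul σ) hle).trans ?_⟩
  rw [integral_const_mul, integral_const_mul]
  refine mul_le_mul_of_nonneg_left ?_ hσ
  have h1 := mul_le_mul_of_nonneg_left (integral_exp_mul_sum_le_pow hW2 mW2 hr)
    (Real.exp_pos (n * (τ * σ / 2))).le
  refine h1.trans (le_of_eq ?_)
  rw [← Real.exp_nat_mul, ← Real.exp_add]
  congr 1
  rw [hnd]
  ring

end Sums

/-! ### Elementary bounds on `log` and `exp` -/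

section Constants

theorem log_le_half {x : ℝ} (hx : 0 < x) : Real.log x ≤ x / 2 := by
  have h1 := Real.log_le_sub_one_of_pos (half_pos hx)
  rw [Real.log_div hx.ne' two_ne_zero] at h1
  linarith [Real.log_two_lt_d9]

theorem exp_neg_log_mul_le {x p : ℝ} (hx : 1 ≤ x) (k : ℕ) (hp : (k : ℝ) ≤ p) :
    Real.exp (-(p * Real.log x)) ≤ 1 / x ^ k := by
  have h0 : 0 < x := by linarith
  have h1 : 1 / x ^ k = Real.exp (-(k * Real.log x)) := by
    rw [Real.exp_neg, Real.exp_nat_mul, Real.exp_log h0, one_div]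
  rw [h1, Real.exp_le_exp, neg_le_neg_iff]
  exact mul_le_mul_of_nonneg_right hp (Real.log_nonneg hx)

theorem exp_neg_div_le {x c : ℝ} (hx : 0 < x) (hc : 0 < c) (k : ℕ) :
    Real.exp (-(x * (1 / c))) ≤ k.factorial * c ^ k / x ^ k := by
  have h := Real.pow_div_factorial_le_exp (x := x * (1 / c)) (by positivity) k
  rw [Real.exp_neg, inv_le_comm₀ (Real.exp_pos _) (by positivity)]
  refine le_trans (le_of_eq ?_) h
  rw [mul_one_div, div_pow]
  field_simp

end Constants

/-! ### Deviations of the estimator and of the empirical variance term -/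

section Deviations

variable {n : ℕ} {Ω : Type*} [MeasurableSpace Ω]

/-- The released observations of index `d` are `Z i d = b (M i + Ξ i)` with independent sums
`M i + Ξ i`, where `M i` has values in `[-1/2, 1/2]` and `Ξ i` is Laplace noise independent
of `M i`. The first two moments of `M i` do not depend on `i`. -/
structure IsNoisyMean (P : Measure Ω) (Z : Fin n → ℕ → Ω → ℝ) (d : ℕ) (M Ξ : Fin n → Ω → ℝ)
    (b c q : ℝ) : Prop where
  pos : 0 < b
  aemeasurable : ∀ i, AEMeasurable (M i) P
  abs_le : ∀ i ω, |M i ω| ≤ 1 / 2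
  measurable : ∀ i, Measurable (Ξ i)
  map_eq : ∀ i, P.map (Ξ i) = laplace
  indepFun : ∀ i, IndepFun (M i) (Ξ i) P
  iIndepFun : iIndepFun (fun i ω => M i ω + Ξ i ω) P
  integral_eq : ∀ i, ∫ ω, M i ω ∂P = c
  integral_sq : ∀ i, ∫ ω, M i ω ^ 2 ∂P = q
  eq : ∀ i ω, Z i d ω = b * (M i ω + Ξ i ω)

namespace IsNoisyMean

variable {P : Measure Ω} {Z : Fin n → ℕ → Ω → ℝ} {d : ℕ}
  {M Ξ : Fin n → Ω → ℝ} {b c q : ℝ}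

theorem aemeasurable_add (h : IsNoisyMean P Z d M Ξ b c q) (i : Fin n) :
    AEMeasurable (fun ω => M i ω + Ξ i ω) P :=
  (h.aemeasurable i).add (h.measurable i).aemeasurable

theorem fHat_sub (h : IsNoisyMean P Z d M Ξ b c q) (hn : (n : ℝ) ≠ 0) (ω : Ω) :
    fHat Z d ω - b * c = b / n * ∑ i, (M i ω + Ξ i ω - c) := by
  simp only [fHat, h.eq, ← Finset.mul_sum, Finset.sum_sub_distrib, Finset.sum_const,
    Finset.card_univ, Fintype.card_fin, nsmul_eq_mul]
  field_simp

theorem sigmaHatSq_eq (h : IsNoisyMean P Z d M Ξ b c q) (ω : Ω) :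
    sigmaHatSq Z d ω = b ^ 2 * ((∑ i, (M i ω + Ξ i ω) ^ 2) / n) := by
  simp only [sigmaHatSq, h.eq, mul_pow, ← Finset.mul_sum]
  ring

variable [IsProbabilityMeasure P]

theorem integral_add_sq (h : IsNoisyMean P Z d M Ξ b c q) (i : Fin n) :
    ∫ ω, (M i ω + Ξ i ω) ^ 2 ∂P = q + 2 := by
  rw [integral_add_laplace_sq (h.aemeasurable i) (h.abs_le i) (h.measurable i) (h.map_eq i)
    (h.indepFun i), h.integral_sq i]

theorem integral_Z_sq (h : IsNoisyMean P Z d M Ξ b c q) (i : Fin n) :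
    ∫ ω, Z i d ω ^ 2 ∂P = b ^ 2 * (q + 2) := by
  simp only [h.eq, mul_pow]
  rw [integral_const_mul, h.integral_add_sq]

theorem integrable_Z_sq (h : IsNoisyMean P Z d M Ξ b c q) (i : Fin n) :
    Integrable (fun ω => Z i d ω ^ 2) P := by
  simp only [h.eq, mul_pow]
  exact (integrable_add_laplace_sq (h.aemeasurable i) (h.abs_le i) (h.measurable i) (h.map_eq i)
    (h.indepFun i)).const_mul _

theorem integrable_VHat (h : IsNoisyMean P Z d M Ξ b c q) : Integrable (VHat Z d) P := by
  have h1 : Integrable (fun ω => ∑ i, Z i d ω ^ 2) P :=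
    integrable_finsetSum _ fun i _ => h.integrable_Z_sq i
  exact (((((h1.const_mul (1 / (n : ℝ))).div_const n).const_mul (2 * c₁)).add
    (integrable_const (c₂ * ((d : ℝ) / n)))).mul_const (Real.log n))

variable [NeZero n]

theorem sigmaSq_eq (h : IsNoisyMean P Z d M Ξ b c q) : sigmaSq P Z d = b ^ 2 * (q + 2) :=
  h.integral_Z_sq 0

theorem q_mem (h : IsNoisyMean P Z d M Ξ b c q) : 2 ≤ q + 2 ∧ q + 2 ≤ 9 / 4 := by
  have h1 := two_le_integral_add_laplace_sq (h.aemeasurable 0) (h.abs_le 0) (h.measurable 0)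
    (h.map_eq 0) (h.indepFun 0)
  have h2 := integral_add_laplace_sq_le (h.aemeasurable 0) (h.abs_le 0) (h.measurable 0)
    (h.map_eq 0) (h.indepFun 0)
  rw [h.integral_add_sq] at h1 h2
  exact ⟨h1, h2⟩

/-- The Laplace variance alone gives `σ_d² ≥ 2b²`, so the variance term dominates the squared noise
scale; the `c₂` term is nonnegative and dropped. -/
theorem le_V (h : IsNoisyMean P Z d M Ξ b c q) :
    1200 * b ^ 2 * (Real.log n / n) ≤ V P Z d := by
  have hn : (1 : ℝ) ≤ n := by exact_mod_cast NeZero.one_le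
  have hl := Real.log_nonneg hn
  rw [V, h.sigmaSq_eq, c₁, c₂]
  have h1 : 0 ≤ 432 * ((d : ℝ) / n) * Real.log n := by positivity
  have h2 : 0 ≤ b ^ 2 * (Real.log n / n) * (q + 2 - 2) :=
    mul_nonneg (by positivity) (by linarith [h.q_mem.1])
  have h3 : (600 * (b ^ 2 * (q + 2) / n) + 432 * ((d : ℝ) / n)) * Real.log n =
      1200 * b ^ 2 * (Real.log n / n) + 600 * (b ^ 2 * (Real.log n / n) * (q + 2 - 2)) +
        432 * ((d : ℝ) / n) * Real.log n := by
    ring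
  linarith

theorem V_nonneg (h : IsNoisyMean P Z d M Ξ b c q) : 0 ≤ V P Z d := by
  have hn : (1 : ℝ) ≤ n := by exact_mod_cast NeZero.one_le
  have hl := Real.log_nonneg hn
  exact le_trans (by positivity) h.le_V

theorem deviation_aux (h : IsNoisyMean P Z d M Ξ b c q) {s x : ℝ} (hs : 0 < s)
    (hs2 : s ^ 2 ≤ 1 / 2) (hx : 0 ≤ x) (hV : (b / n) ^ 2 * x ^ 2 ≤ V P Z d / 22) :
    Integrable (fun ω => max ((fHat Z d ω - b * c) ^ 2 - V P Z d / 22) 0) P ∧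
    ∫ ω, max ((fHat Z d ω - b * c) ^ 2 - V P Z d / 22) 0 ∂P ≤
      (b / n) ^ 2 * ((2 * x / s + 2 / s ^ 2) * (2 * Real.exp (n * (17 / 8 * s ^ 2) - s * x))) := by
  have hn : (n : ℝ) ≠ 0 := by exact_mod_cast NeZero.ne n
  have mW : ∀ i, AEMeasurable (fun ω => M i ω + Ξ i ω - c) P :=
    fun i => (h.aemeasurable_add i).sub_const c
  have hind : ProbabilityTheory.iIndepFun (fun i ω => M i ω + Ξ i ω - c) P :=
    h.iIndepFun.comp (fun _ u => u - c) fun _ => by fun_prop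
  have hm : ∀ i, ∀ r : ℝ, r ^ 2 ≤ 1 / 2 →
      mgf (fun ω => M i ω + Ξ i ω - c) P r ≤ Real.exp (17 / 8 * r ^ 2) := fun i r hr => by
    have := mgf_add_laplace_sub_le (h.aemeasurable i) (h.abs_le i) (h.measurable i)
      (h.map_eq i) (h.indepFun i) hr
    rwa [h.integral_eq] at this
  have hi : ∀ i, ∀ r : ℝ, r ^ 2 ≤ 1 / 2 →
      Integrable (fun ω => Real.exp (r * (M i ω + Ξ i ω - c))) P := fun i r hr =>
    integrable_exp_add_laplace (h.aemeasurable i) (h.abs_le i) (h.measurable i)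
      (h.map_eq i) (h.indepFun i) hr c
  have hs2' : (-s) ^ 2 ≤ 1 / 2 := by rwa [neg_sq]
  obtain ⟨k1, k2⟩ := integral_max_sum_sq_sub_le hind mW hs hx (fun i => hi i s hs2)
    (fun i => hi i (-s) hs2') (fun i => hm i s hs2)
    (fun i => (hm i (-s) hs2').trans (by rw [neg_sq]))
  rw [Fintype.card_fin] at k2
  have hle : ∀ ω, max ((fHat Z d ω - b * c) ^ 2 - V P Z d / 22) 0 ≤
      (b / n) ^ 2 * max ((∑ i, (M i ω + Ξ i ω - c)) ^ 2 - x ^ 2) 0 := fun ω => by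
    rw [h.fHat_sub hn, mul_pow]
    refine max_le ?_ (by positivity)
    have := mul_le_mul_of_nonneg_left (le_max_left ((∑ i, (M i ω + Ξ i ω - c)) ^ 2 - x ^ 2) 0)
      (sq_nonneg (b / (n : ℝ)))
    linarith
  have hint : Integrable (fun ω => max ((fHat Z d ω - b * c) ^ 2 - V P Z d / 22) 0) P := by
    refine (k1.const_mul ((b / (n : ℝ)) ^ 2)).mono' ?_ (Filter.Eventually.of_forall fun ω => ?_)
    · simp only [h.fHat_sub hn]
      have mS : AEMeasurable (fun ω => ∑ i, (M i ω + Ξ i ω - c)) P :=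
        Finset.aemeasurable_fun_sum _ fun i _ => mW i
      exact ((((mS.const_mul _).pow_const 2).sub_const _).max
        aemeasurable_const).aestronglyMeasurable
    · rw [Real.norm_of_nonneg (le_max_right _ _)]
      exact hle ω
  refine ⟨hint, (integral_mono hint (k1.const_mul _) hle).trans ?_⟩
  rw [integral_const_mul]
  exact mul_le_mul_of_nonneg_left k2 (sq_nonneg _)

/-- The Chernoff parameter is `s = √(log n / n)`, so that `n s² = log n` and the exponential becomes
a power of `n`. -/
theorem deviation (h : IsNoisyMean P Z d M Ξ b c q) :
    Integrable (fun ω => max ((fHat Z d ω - b * c) ^ 2 - V P Z d / 22) 0) P ∧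
    ∫ ω, max ((fHat Z d ω - b * c) ^ 2 - V P Z d / 22) 0 ∂P ≤ 48 * (b ^ 2 / n ^ 6) := by
  rcases (NeZero.one_le (n := n)).eq_or_lt with h1 | h2
  · have hn : (n : ℝ) = 1 := by exact_mod_cast h1.symm
    -- For `n = 1` the logarithm vanishes and the general `s` would be zero. A fixed `s` with no
    -- truncation gives `16 exp (17/32) b² ≤ 48 b²`, the source of the constant `48`.
    obtain ⟨k1, k2⟩ := h.deviation_aux (s := 1 / 2) (x := 0) (by norm_num) (by norm_num) le_rfl
      (by rw [zero_pow two_ne_zero, mul_zero]; linarith [h.V_nonneg])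
    refine ⟨k1, k2.trans ?_⟩
    rw [hn]
    have he : Real.exp (1 * (17 / 8 * (1 / 2) ^ 2) - 1 / 2 * 0) ≤ 3 := by
      refine le_trans (Real.exp_le_exp.2 (by norm_num : _ ≤ (1 : ℝ))) ?_
      linarith [Real.exp_one_lt_d9]
    have hb : 0 ≤ b ^ 2 := sq_nonneg b
    norm_num at he ⊢
    nlinarith
  · have hn2 : (2 : ℝ) ≤ n := by exact_mod_cast h2
    have hn : (0 : ℝ) < n := by linarith
    have hlog : 0.69 ≤ Real.log n :=
      (by linarith [Real.log_two_gt_d9] : (0.69 : ℝ) ≤ Real.log 2).trans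
        (Real.log_le_log two_pos hn2)
    have hl : 0 < Real.log n := by linarith
    have hL : 0 < Real.log n / n := by positivity
    set s := Real.sqrt (Real.log n / n) with hsd
    have hs : 0 < s := Real.sqrt_pos.2 hL
    have hss : s ^ 2 = Real.log n / n := Real.sq_sqrt hL.le
    have hns : n * s ^ 2 = Real.log n := by rw [hss]; field_simp
    -- The value `29/4` fits two constraints: `(29/4)² = 841/16 ≤ 1200/22`, so the threshold stays
    -- below `V / 22`, and `29/4 - 17/8 = 41/8 ≥ 5`, so the exponential is at most `n⁻⁵`.
    obtain ⟨k1, k2⟩ := h.deviation_aux (s := s) (x := 29 / 4 * n * s) hs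
      (by rw [hss, div_le_iff₀ hn]; linarith [log_le_half hn]) (by positivity) (by
        have e1 : (b / n) ^ 2 * (29 / 4 * n * s) ^ 2 = 841 / 16 * b ^ 2 * s ^ 2 := by
          field_simp
          ring
        rw [e1, hss]
        have := h.le_V
        have h0 : 0 ≤ b ^ 2 * (Real.log n / n) := by positivity
        linarith)
    refine ⟨k1, k2.trans ?_⟩
    have e2 : n * (17 / 8 * s ^ 2) - s * (29 / 4 * n * s) = -(41 / 8 * Real.log n) := by
      rw [← hns]
      ring
    have e3 : 2 * (29 / 4 * n * s) / s + 2 / s ^ 2 ≤ 18 * n := by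
      have e4 : 2 * (29 / 4 * n * s) / s + 2 / s ^ 2 = 29 / 2 * n + 2 / Real.log n * n := by
        rw [hss]
        field_simp
        ring
      have e5 : 2 / Real.log n ≤ 3 := by
        rw [div_le_iff₀ hl]
        linarith
      have := mul_le_mul_of_nonneg_right e5 hn.le
      rw [e4]
      linarith
    have e6 := exp_neg_log_mul_le (x := n) (p := 41 / 8) (by linarith) 5 (by norm_num)
    rw [e2]
    calc (b / n) ^ 2 * ((2 * (29 / 4 * n * s) / s + 2 / s ^ 2) *
          (2 * Real.exp (-(41 / 8 * Real.log n))))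
        ≤ (b / n) ^ 2 * (18 * n * (2 * (1 / n ^ 5))) := by gcongr
      _ = 36 * (b ^ 2 / n ^ 6) := by
          field_simp
          ring
      _ ≤ 48 * (b ^ 2 / n ^ 6) := by
          gcongr
          norm_num

theorem V_sub_VHat (h : IsNoisyMean P Z d M Ξ b c q) (ω : Ω) :
    V P Z d - VHat Z d ω = 600 * (Real.log n / n) * b ^ 2 *
      (q + 2 - 2 * ((∑ i, (M i ω + Ξ i ω) ^ 2) / n)) := by
  rw [V, VHat, h.sigmaSq_eq, h.sigmaHatSq_eq, c₁, c₂]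
  ring

/-- In `V - V̂` the `c₂` terms cancel and a multiple of `σ² - 2σ̂²` remains, which is positive only
if the empirical second moment falls below half its mean. That has exponentially small cost `exp (-n
/ 388)`, traded for `6! · 388⁶ / n⁶`. -/
theorem lower_deviation (h : IsNoisyMean P Z d M Ξ b c q) :
    Integrable (fun ω => max (V P Z d - VHat Z d ω) 0) P ∧
    ∫ ω, max (V P Z d - VHat Z d ω) 0 ∂P ≤ 675 * (720 * 388 ^ 6) * (b ^ 2 / n ^ 6) := by
  have hn1 : (1 : ℝ) ≤ n := by exact_mod_cast NeZero.one_le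
  have hn : (0 : ℝ) < n := by linarith
  have hl := Real.log_nonneg hn1
  have hne : Nonempty (Fin n) := ⟨0⟩
  obtain ⟨q1, q2⟩ := h.q_mem
  obtain ⟨k1, k2⟩ := integral_max_sub_sum_sq_le h.iIndepFun h.aemeasurable_add (σ := q + 2)
    -- Since `σ ≥ 2`, the requirement `τσ / 2 - 193 τ² / 2 ≥ v` reduces to `τ - 193 τ² / 2 ≥ v`,
    -- which these values satisfy.
    (τ := 1 / 194) (v := 1 / 388) (by linarith) (by norm_num) (fun i => by
      refine (integral_exp_neg_add_laplace_sq_le (h.aemeasurable i) (h.abs_le i) (h.measurable i)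
        (h.map_eq i) (h.indepFun i) (by norm_num)).trans (Real.exp_le_exp.2 ?_)
      rw [h.integral_add_sq]
      linarith)
  rw [Fintype.card_fin] at k1 k2
  have hc : 0 ≤ 600 * (Real.log n / n) * b ^ 2 := by positivity
  have heq : ∀ ω, max (V P Z d - VHat Z d ω) 0 = 600 * (Real.log n / n) * b ^ 2 *
      max (q + 2 - 2 * ((∑ i, (M i ω + Ξ i ω) ^ 2) / n)) 0 := fun ω => by
    rw [h.V_sub_VHat, mul_max_of_nonneg _ _ hc, mul_zero]
  simp only [heq]
  refine ⟨k1.const_mul _, ?_⟩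
  rw [integral_const_mul]
  have hL : Real.log n / n ≤ 1 / 2 := by
    rw [div_le_iff₀ hn]
    linarith [log_le_half hn]
  have he := exp_neg_div_le (x := n) (c := 388) hn (by norm_num) 6
  have h720 : ((Nat.factorial 6 : ℕ) : ℝ) = 720 := by norm_num [Nat.factorial]
  rw [h720] at he
  calc 600 * (Real.log n / n) * b ^ 2 *
        ∫ ω, max (q + 2 - 2 * ((∑ i, (M i ω + Ξ i ω) ^ 2) / n)) 0 ∂P
      ≤ 600 * (1 / 2) * b ^ 2 * (9 / 4 * (720 * 388 ^ 6 / n ^ 6)) := by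
        refine mul_le_mul (by gcongr) (k2.trans ?_) (integral_nonneg fun ω => le_max_right _ _)
          (by positivity)
        exact mul_le_mul q2 he (Real.exp_pos _).le (by norm_num)
    _ = 675 * (720 * 388 ^ 6) * (b ^ 2 / n ^ 6) := by ring

theorem integral_VHat_le (h : IsNoisyMean P Z d M Ξ b c q) :
    ∫ ω, VHat Z d ω ∂P ≤ 2 * V P Z d := by
  have hn1 : (1 : ℝ) ≤ n := by exact_mod_cast NeZero.one_le
  have hn : (n : ℝ) ≠ 0 := by linarith
  have hl := Real.log_nonneg hn1
  have h1 : Integrable (fun ω => ∑ i, Z i d ω ^ 2) P :=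
    integrable_finsetSum _ fun i _ => h.integrable_Z_sq i
  have h2 : ∫ ω, sigmaHatSq Z d ω ∂P = sigmaSq P Z d := by
    simp only [sigmaHatSq]
    rw [integral_const_mul, integral_finsetSum _ fun i _ => h.integrable_Z_sq i]
    simp only [h.integral_Z_sq, h.sigmaSq_eq, Finset.sum_const, Finset.card_univ,
      Fintype.card_fin, nsmul_eq_mul]
    field_simp
  have h3 : Integrable (sigmaHatSq Z d) P := h1.const_mul (1 / (n : ℝ))
  simp only [VHat]
  rw [integral_mul_const, integral_add ((h3.div_const _).const_mul _) (integrable_const _),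
    integral_const_mul, integral_div, h2, V]
  simp only [integral_const, probReal_univ, smul_eq_mul, one_mul]
  have h4 : 0 ≤ c₂ * ((d : ℝ) / n) * Real.log n := by
    rw [c₂]
    positivity
  linarith

end IsNoisyMean

end Deviations

/-! ### Pathwise oracle inequality -/

section Oracle

variable {n : ℕ} {Ω : Type*} {𝒟 : Finset ℕ} {Z : Fin n → ℕ → Ω → ℝ}

theorem AHat_nonneg (d : ℕ) (ω : Ω) : 0 ≤ AHat 𝒟 Z d ω :=
  NNReal.coe_nonneg _

theorem sq_sub_le_AHat {d D : ℕ} (hD : D ∈ 𝒟) (hdD : d ≤ D) (ω : Ω) :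
    (fHat Z d ω - fHat Z D ω) ^ 2 ≤ AHat 𝒟 Z d ω + VHat Z d ω + VHat Z D ω := by
  have h1 : Real.toNNReal (|fHat Z d ω - fHat Z D ω| ^ 2 - (VHat Z d ω + VHat Z D ω)) ≤
      (𝒟.filter fun D => d ≤ D).sup fun D =>
        Real.toNNReal (|fHat Z d ω - fHat Z D ω| ^ 2 - (VHat Z d ω + VHat Z D ω)) :=
    Finset.le_sup (f := fun D =>
      Real.toNNReal (|fHat Z d ω - fHat Z D ω| ^ 2 - (VHat Z d ω + VHat Z D ω)))
      (Finset.mem_filter.2 ⟨hD, hdD⟩)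
  have h2 := (Real.le_coe_toNNReal _).trans (NNReal.coe_le_coe.2 h1)
  rw [sq_abs] at h2
  rw [AHat]
  simp only [sq_abs] at h2 ⊢
  linarith

theorem AHat_le {d : ℕ} {ω : Ω} {r : ℝ} (hr : 0 ≤ r)
    (h : ∀ D ∈ 𝒟, d ≤ D → (fHat Z d ω - fHat Z D ω) ^ 2 - (VHat Z d ω + VHat Z D ω) ≤ r) :
    AHat 𝒟 Z d ω ≤ r := by
  rw [AHat, ← Real.coe_toNNReal r hr, NNReal.coe_le_coe]
  refine Finset.sup_le fun D hD => Real.toNNReal_le_toNNReal ?_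
  rw [sq_abs]
  exact h D (Finset.mem_filter.1 hD).1 (Finset.mem_filter.1 hD).2

variable (F v : ℕ → ℝ)

/-- The excess of the stochastic error over the variance term, at dimension `d`. -/
def excess (Z : Fin n → ℕ → Ω → ℝ) (d : ℕ) (ω : Ω) : ℝ :=
  22 * max ((fHat Z d ω - F d) ^ 2 - v d / 22) 0 + max (v d - VHat Z d ω) 0

theorem excess_nonneg (d : ℕ) (ω : Ω) : 0 ≤ excess F v Z d ω := by
  unfold excess
  positivity

theorem sq_error_le_excess (d : ℕ) (ω : Ω) :
    22 * (fHat Z d ω - F d) ^ 2 ≤ v d + excess F v Z d ω := by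
  have h1 := le_max_left ((fHat Z d ω - F d) ^ 2 - v d / 22) 0
  have h2 := le_max_right (v d - VHat Z d ω) 0
  unfold excess
  linarith

/-- The two positive parts telescope: the first replaces the squared error by `v d`, the second
replaces `v d` by the observable `V̂(d)`. -/
theorem sq_error_le_VHat_add_excess (d : ℕ) (ω : Ω) :
    22 * (fHat Z d ω - F d) ^ 2 ≤ VHat Z d ω + excess F v Z d ω := by
  have h1 := le_max_left ((fHat Z d ω - F d) ^ 2 - v d / 22) 0
  have h2 := le_max_left (v d - VHat Z d ω) 0
  unfold excess
  linarith

theorem excess_le_sum {d : ℕ} (hd : d ∈ 𝒟) (ω : Ω) :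
    excess F v Z d ω ≤ ∑ D ∈ 𝒟, excess F v Z D ω :=
  Finset.single_le_sum (f := fun D => excess F v Z D ω) (fun D _ => excess_nonneg F v D ω) hd

variable {F v}

/-- The difference of two estimators splits into a bias difference and a noise difference.
Subtracting `V̂(d) + V̂(D)` absorbs the noise up to excesses, because `22` times each squared error
is at most `V̂` plus an excess. -/
theorem AHat_le_bias_add_excess {d : ℕ} (hd : d ∈ 𝒟) {s B : ℝ} (ω : Ω)
    (hB : ∀ D, d ≤ D → (F D - s) ^ 2 ≤ B) :
    AHat 𝒟 Z d ω ≤ 22 / 5 * B + 2 * ∑ D ∈ 𝒟, excess F v Z D ω := by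
  have hB0 : 0 ≤ B := (sq_nonneg _).trans (hB d le_rfl)
  have hS : 0 ≤ ∑ D ∈ 𝒟, excess F v Z D ω :=
    Finset.sum_nonneg fun D _ => excess_nonneg F v D ω
  refine AHat_le (by positivity) fun D hD hdD => ?_
  have h1 := sq_error_le_VHat_add_excess F v (Z := Z) d ω
  have h2 := sq_error_le_VHat_add_excess F v (Z := Z) D ω
  have h3 := excess_le_sum F v (Z := Z) hd ω
  have h4 := excess_le_sum F v (Z := Z) hD ω
  have h5 := hB d le_rfl
  have h6 := hB D hdD
  set x := fHat Z d ω - F d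
  set y := fHat Z D ω - F D
  set p := F d - s
  set r := F D - s
  have h7 : fHat Z d ω - fHat Z D ω = (p - r) + (x - y) := by
    simp only [x, y, p, r]
    ring
  -- Weighted Young inequality: almost all the weight goes to the noise, which keeps the bias
  -- constant at `4 · 11/10 = 22/5`; the noise weight `2 · 11` is the `22` in `excess`.
  have h8 : ((p - r) + (x - y)) ^ 2 ≤ 11 / 10 * (p - r) ^ 2 + 11 * (x - y) ^ 2 := by
    nlinarith [sq_nonneg ((p - r) - 10 * (x - y))]
  have h9 : (p - r) ^ 2 ≤ 2 * p ^ 2 + 2 * r ^ 2 := by nlinarith [sq_nonneg (p + r)]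
  have h10 : (x - y) ^ 2 ≤ 2 * x ^ 2 + 2 * y ^ 2 := by nlinarith [sq_nonneg (x + y)]
  rw [h7]
  linarith

/-- The deterministic oracle inequality for the selected dimension. -/
theorem sq_error_selector_le [MeasurableSpace Ω] {dHat : Ω → ℕ} (hsel : IsSelector 𝒟 Z dHat)
    {d : ℕ} (hd : d ∈ 𝒟) {s B : ℝ} (ω : Ω) (hB : ∀ D, d ≤ D → (F D - s) ^ 2 ≤ B)
    (hv : 0 ≤ v d) :
    |fHat Z (dHat ω) ω - s| ^ 2 ≤
      16 * B + 9 * ∑ D ∈ 𝒟, excess F v Z D ω + 8 / 3 * VHat Z d ω + 3 * v d := by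
  have hA := AHat_le_bias_add_excess (v := v) (Z := Z) hd ω hB
  have hS : 0 ≤ ∑ D ∈ 𝒟, excess F v Z D ω :=
    Finset.sum_nonneg fun D _ => excess_nonneg F v D ω
  have hmin := hsel.le ω d hd
  -- The comparison is charged to `Â` at the smaller of the two dimensions; minimality of `dHat ω`
  -- then replaces its criterion by that of `d`.
  have hdist : (fHat Z (dHat ω) ω - fHat Z d ω) ^ 2 ≤ 2 * (AHat 𝒟 Z d ω + VHat Z d ω) := by
    rcases le_total d (dHat ω) with h | h
    · have h1 := sq_sub_le_AHat (Z := Z) (hsel.mem ω) h ω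
      have h2 := AHat_nonneg (𝒟 := 𝒟) (Z := Z) (dHat ω) ω
      have h3 : (fHat Z (dHat ω) ω - fHat Z d ω) ^ 2 = (fHat Z d ω - fHat Z (dHat ω) ω) ^ 2 := by
        ring
      linarith
    · have h1 := sq_sub_le_AHat (Z := Z) hd h ω
      have h2 := AHat_nonneg (𝒟 := 𝒟) (Z := Z) d ω
      linarith
  have h1 := sq_error_le_excess F v (Z := Z) d ω
  have h2 := excess_le_sum F v (Z := Z) hd ω
  have h3 := hB d le_rfl
  set x := fHat Z d ω - F d
  set p := F d - s
  set z := fHat Z (dHat ω) ω - fHat Z d ω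
  have h4 : fHat Z (dHat ω) ω - s = z + (x + p) := by
    simp only [x, p, z]
    ring
  have h5 : (z + (x + p)) ^ 2 ≤ 4 / 3 * z ^ 2 + 4 * (x + p) ^ 2 := by
    -- The Young weights here and in the next step make the bias constant exactly `8/3 · 22/5 + 4 ·
    -- 16/15 = 16`. The excess constant is `16/3 + 64/22 ≤ 9`, and that of `v d` is `64/22 ≤ 3`.
    nlinarith [sq_nonneg (z - 3 * (x + p))]
  have h6 : (x + p) ^ 2 ≤ 16 * x ^ 2 + 16 / 15 * p ^ 2 := by
    nlinarith [sq_nonneg (15 * x - p)]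
  rw [sq_abs, h4]
  linarith

end Oracle

/-! ### The privatised observations as noisy means -/

section Model

variable {φ : ℕ → unitInterval → ℝ} {φo : ℝ}

/-- Integrate `φ₀² ≤ φo` over the unit interval. This makes the noise scale strictly positive. -/
theorem one_le_of_supNormBound (hφ : IsOrthonormalSystem φ) (hb : SupNormBound φ φo) :
    1 ≤ φo := by
  have h1 := hφ.integral_mul 0 0
  have h2 : ∀ x, φ 0 x * φ 0 x ≤ φo := fun x => by
    have := hb 1 le_rfl x
    simp only [Finset.sum_range_one, Nat.cast_one, one_mul] at this
    linarith [sq (φ 0 x)]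
  have h3 : ∫ x, φ 0 x * φ 0 x ≤ ∫ _ : unitInterval, φo :=
    integral_mono_of_nonneg (Filter.Eventually.of_forall fun x => mul_self_nonneg _)
      (integrable_const _) (Filter.Eventually.of_forall h2)
  simpa [h1] using h3

theorem abs_g_le (hb : SupNormBound φ φo) {d : ℕ} (hd : 1 ≤ d) (t x : unitInterval) :
    |g φ t d x| ≤ d * φo := by
  have h0 : 0 ≤ (d : ℝ) * φo :=
    (Finset.sum_nonneg fun j _ => sq_nonneg (φ j x)).trans (hb d hd x)
  refine abs_le_of_sq_le_sq ?_ h0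
  refine (Finset.sum_mul_sq_le_sq_mul_sq _ _ _).trans ?_
  rw [sq]
  exact mul_le_mul (hb d hd x) (hb d hd t) (Finset.sum_nonneg fun j _ => sq_nonneg _) h0

theorem aemeasurable_g (hφ : IsOrthonormalSystem φ) (t : unitInterval) (d : ℕ) :
    AEMeasurable (g φ t d) volume :=
  Finset.aemeasurable_fun_sum _ fun j _ =>
    ((hφ.memLp j).aestronglyMeasurable.aemeasurable.mul_const _)

theorem integral_g (hφ : IsOrthonormalSystem φ) {f : unitInterval → ℝ}
    (hf : IsSqIntegrableDensity f) (t : unitInterval) (d : ℕ) :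
    ∫ x, g φ t d x ∂(volume.withDensity fun x => ENNReal.ofReal (f x)) = proj φ f d t := by
  rw [integral_withDensity_eq_integral_toReal_smul₀
    hf.memLp.aestronglyMeasurable.aemeasurable.ennreal_ofReal (by simp)]
  have h1 : ∀ x, (ENNReal.ofReal (f x)).toReal • g φ t d x =
      ∑ j ∈ Finset.range d, f x * φ j x * φ j t := fun x => by
    rw [ENNReal.toReal_ofReal (hf.nonneg x), smul_eq_mul, g, Finset.mul_sum]
    exact Finset.sum_congr rfl fun j _ => by ring
  simp only [h1]
  have h2 : ∀ j, Integrable (fun x => f x * φ j x) := fun j =>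
    hf.memLp.integrable_mul (hφ.memLp j)
  rw [integral_finsetSum _ fun j _ => (h2 j).mul_const _, proj]
  exact Finset.sum_congr rfl fun j _ => integral_mul_const _ _

variable {n : ℕ} {Ω : Type*} [MeasurableSpace Ω] {P : Measure Ω} [IsProbabilityMeasure P]
  {X : Fin n → Ω → unitInterval} {ξ : Fin n → ℕ → Ω → ℝ} {𝒟 : Finset ℕ}

theorem isNoisyMean_privatize (hφ : IsOrthonormalSystem φ) (hb : SupNormBound φ φo)
    {f : unitInterval → ℝ} (hf : IsSqIntegrableDensity f) (t : unitInterval) {α : ℝ}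
    (hα : 0 < α) (hα1 : α < 1) (h𝒟 : ∀ d ∈ 𝒟, 1 ≤ d)
    (mX : ∀ i, Measurable (X i)) (mξ : ∀ i, ∀ d ∈ 𝒟, Measurable (ξ i d))
    (hX : ∀ i, P.map (X i) = volume.withDensity fun x => ENNReal.ofReal (f x))
    (hXi : iIndepFun X P) (hξ : ∀ i, ∀ d ∈ 𝒟, P.map (ξ i d) = laplace)
    (hξi : iIndepFun (fun p : Fin n × 𝒟 => ξ p.1 p.2) P)
    (hXξ : IndepFun (fun ω i => X i ω) (fun ω (p : Fin n × 𝒟) => ξ p.1 p.2 ω) P)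
    {Z : Fin n → ℕ → Ω → ℝ}
    (hZ : ∀ i, ∀ d ∈ 𝒟, ∀ ω, Z i d ω = privatize φ t φo (α / 𝒟.card) d (X i ω) (ξ i d ω))
    {d : ℕ} (hd : d ∈ 𝒟) :
    ∃ M : Fin n → Ω → ℝ, ∃ q, IsNoisyMean P Z d M (fun i => ξ i d)
      (2 * φo * d / (α / 𝒟.card)) (proj φ f d t / (2 * φo * d / (α / 𝒟.card))) q := by
  have hφo := one_le_of_supNormBound hφ hb
  have hd1 : (1 : ℝ) ≤ d := by exact_mod_cast h𝒟 d hd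
  have hc1 : (1 : ℝ) ≤ 𝒟.card := by exact_mod_cast Finset.card_pos.2 ⟨d, hd⟩
  set b : ℝ := 2 * φo * d / (α / 𝒟.card) with hbd
  have hb0 : 0 < b := by positivity
  have hble : 2 * (d * φo) ≤ b := by
    rw [hbd, le_div_iff₀ (by positivity)]
    have h1 : α / 𝒟.card ≤ 1 := by
      rw [div_le_one (by linarith)]
      linarith
    have h2 := mul_le_mul_of_nonneg_left h1 (by positivity : 0 ≤ 2 * (d * φo))
    linarith
  -- The basis functions are only a.e. measurable for Lebesgue measure; absolute continuity of the
  -- law of `X i` transfers this.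
  have mg : ∀ i, AEMeasurable (fun x => g φ t d x / b) (P.map (X i)) := fun i => by
    rw [hX i]
    exact ((aemeasurable_g hφ t d).div_const b).mono_ac (withDensity_absolutelyContinuous _ _)
  have hpair : ∀ i, IndepFun (X i) (ξ i d) P := fun i =>
    hXξ.comp (measurable_pi_apply i) (measurable_pi_apply (i, (⟨d, hd⟩ : 𝒟)))
  refine ⟨fun i ω => g φ t d (X i ω) / b,
    ∫ x, (g φ t d x / b) ^ 2 ∂(volume.withDensity fun x => ENNReal.ofReal (f x)), ?_⟩
  refine ⟨hb0, fun i => (mg i).comp_measurable (mX i), fun i ω => ?_, fun i => mξ i d hd,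
    fun i => hξ i d hd, fun i => ?_, ?_, fun i => ?_, fun i => ?_, fun i ω => ?_⟩
  · rw [abs_div, abs_of_pos hb0, div_le_iff₀ hb0]
    linarith [abs_g_le hb (h𝒟 d hd) t (X i ω)]
  · exact (hpair i).comp₀ (mX i).aemeasurable (mξ i d hd).aemeasurable (mg i) aemeasurable_id
  · have h1 : iIndepFun (fun i => ξ i d) P :=
      hξi.precomp (g := fun i => (i, (⟨d, hd⟩ : 𝒟))) fun i j hij => (Prod.ext_iff.1 hij).1
    have h2 : IndepFun (fun ω i => X i ω) (fun ω i => ξ i d ω) P :=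
      hXξ.comp measurable_id (show Measurable fun (u : Fin n × 𝒟 → ℝ) (i : Fin n) =>
        u (i, (⟨d, hd⟩ : 𝒟)) by fun_prop)
    have h3 := iIndepFun_prodMk_of_indepFun mX (fun i => mξ i d hd) hXi h1 h2
    refine h3.comp₀ (fun _ p => g φ t d p.1 / b + p.2)
      (fun i => ((mX i).prodMk (mξ i d hd)).aemeasurable) fun i => ?_
    have h4 : AEMeasurable (fun x => g φ t d x / b)
        ((P.map fun ω => (X i ω, ξ i d ω)).map Prod.fst) := by
      rw [Measure.map_map measurable_fst ((mX i).prodMk (mξ i d hd))]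
      exact mg i
    exact (h4.comp_measurable measurable_fst).add measurable_snd.aemeasurable
  · rw [← integral_g hφ hf, ← hX i, ← integral_div,
      integral_map (mX i).aemeasurable (mg i).aestronglyMeasurable]
  · rw [← hX i, integral_map (mX i).aemeasurable ((mg i).pow_const 2).aestronglyMeasurable]
  · rw [hZ i d hd, privatize, mul_add, mul_div_cancel₀ _ hb0.ne']

/-- The scale is `2 φo d m / α` with `d m ≤ n²`, so its square costs `n⁴`. The power `n⁶` leaves
`n⁻²`, one factor of which pays for the sum over `𝒟`. -/
theorem noise_scale_sq_le {α φo : ℝ} {d m n : ℕ} (hφo : 0 ≤ φo) (hα : 0 < α) (hn : 0 < n)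
    (hd : d ≤ n) (hm : m ≤ n) :
    (2 * φo * d / (α / m)) ^ 2 / n ^ 6 ≤ 4 * φo ^ 2 / (n ^ 2 * α ^ 2) := by
  have h1 : (d : ℝ) ≤ n := by exact_mod_cast hd
  have h2 : (m : ℝ) ≤ n := by exact_mod_cast hm
  have h3 : (0 : ℝ) < n := by exact_mod_cast hn
  have h4 : 2 * φo * d / (α / m) = 2 * φo / α * (d * m) := by
    rw [div_div_eq_mul_div]
    ring
  have h5 : (d : ℝ) * m ≤ n * n := by gcongr
  rw [h4]
  calc (2 * φo / α * (d * m)) ^ 2 / (n : ℝ) ^ 6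
      ≤ (2 * φo / α * (n * n)) ^ 2 / (n : ℝ) ^ 6 := by gcongr
    _ = 4 * φo ^ 2 / (n ^ 2 * α ^ 2) := by
        field_simp
        ring

end Model

/-! ### Expected excess and conclusion -/

namespace IsNoisyMean

variable {n : ℕ} [NeZero n] {Ω : Type*} [MeasurableSpace Ω] {P : Measure Ω}
  [IsProbabilityMeasure P] {Z : Fin n → ℕ → Ω → ℝ} {d : ℕ} {M Ξ : Fin n → Ω → ℝ} {b q : ℝ}

theorem integral_excess_le {F : ℕ → ℝ} (h : IsNoisyMean P Z d M Ξ b (F d / b) q) :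
    Integrable (excess F (V P Z) Z d) P ∧
    ∫ ω, excess F (V P Z) Z d ω ∂P ≤ (1056 + 675 * (720 * 388 ^ 6)) * (b ^ 2 / n ^ 6) := by
  obtain ⟨k1, k2⟩ := h.deviation
  obtain ⟨k3, k4⟩ := h.lower_deviation
  rw [mul_div_cancel₀ _ h.pos.ne'] at k1 k2
  refine ⟨(k1.const_mul 22).add k3, ?_⟩
  simp only [excess]
  rw [integral_add (k1.const_mul 22) k3, integral_const_mul]
  linarith

end IsNoisyMean

theorem sq_le_toReal_biasSq {φ : ℕ → unitInterval → ℝ} {f : unitInterval → ℝ} {t : unitInterval}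
    {d D : ℕ} (hdD : d ≤ D) (hfin : biasSq φ f t d ≠ ⊤) :
    (proj φ f D t - f t) ^ 2 ≤ (biasSq φ f t d).toReal := by
  rw [← sq_abs, ← ENNReal.ofReal_le_iff_le_toReal hfin]
  exact le_iSup₂ (f := fun D (_ : d ≤ D) => ENNReal.ofReal (|proj φ f D t - f t| ^ 2)) D hdD

end PrivProj
end

open PrivProj in
theorem mainTheorem3 (φo : ℝ) :
    ∃ C : ℝ, 0 < C ∧
      ∀ (φ : ℕ → unitInterval → ℝ), IsOrthonormalSystem φ → SupNormBound φ φo →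
      ∀ (f : unitInterval → ℝ), IsSqIntegrableDensity f →
      ∀ (t : unitInterval) (α : ℝ), 0 < α → α < 1 →
      ∀ (n : ℕ) [NeZero n] (𝒟 : Finset ℕ), (∀ d ∈ 𝒟, 1 ≤ d) → 𝒟.card ≤ n →
        (∀ d ∈ 𝒟, max (Real.log n) 1 ≤ (n : ℝ) / d) →
      ∀ {Ω : Type*} [MeasurableSpace Ω] (P : Measure Ω) [IsProbabilityMeasure P]
        (X : Fin n → Ω → unitInterval) (ξ : Fin n → ℕ → Ω → ℝ),
        (∀ i, Measurable (X i)) → (∀ i, ∀ d ∈ 𝒟, Measurable (ξ i d)) →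
        -- the raw observations are iid with density `f`
        (∀ i, P.map (X i) = volume.withDensity fun x => ENNReal.ofReal (f x)) →
        iIndepFun X P →
        -- the noise variables are iid standard Laplace and independent of the raw observations
        (∀ i, ∀ d ∈ 𝒟, P.map (ξ i d) = laplace) →
        iIndepFun (fun p : Fin n × 𝒟 => ξ p.1 p.2) P →
        IndepFun (fun ω i => X i ω) (fun ω (p : Fin n × 𝒟) => ξ p.1 p.2 ω) P →
      -- the released observations, with privacy parameter `α / |𝒟|`
      ∀ (Z : Fin n → ℕ → Ω → ℝ),
        (∀ i, ∀ d ∈ 𝒟, ∀ ω, Z i d ω = privatize φ t φo (α / 𝒟.card) d (X i ω) (ξ i d ω)) →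
      ∀ (dHat : Ω → ℕ), IsSelector 𝒟 Z dHat →
        ∫⁻ ω, ENNReal.ofReal (|fHat Z (dHat ω) ω - f t| ^ 2) ∂P ≤
          16 * (⨅ d ∈ 𝒟, (biasSq φ f t d + ENNReal.ofReal (V P Z d))) +
            ENNReal.ofReal (C * φo ^ 2 / (n * α ^ 2)) := by
  -- Here `36 = 9 · 4`, from the excess weight in the pathwise inequality and the squared noise
  -- scale; `1056 = 22 · 48`.
  refine ⟨36 * (1056 + 675 * (720 * 388 ^ 6)), by norm_num, ?_⟩
  intro φ hφ hb f hf t α hα hα1 n _ 𝒟 h𝒟 hcard hdn Ω _ P _ X ξ mX mξ hX hXi hξ hξi hXξ Z hZ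
    dHat hsel
  have hφo := one_le_of_supNormBound hφ hb
  have hn : 0 < n := Nat.pos_of_ne_zero (NeZero.ne n)
  have hn' : (0 : ℝ) < n := by exact_mod_cast hn
  obtain ⟨ω₀⟩ := nonempty_of_isProbabilityMeasure P
  have hne : 𝒟.Nonempty := ⟨_, hsel.mem ω₀⟩
  have hmodel : ∀ d ∈ 𝒟, _ := fun d hd =>
    isNoisyMean_privatize hφ hb hf t hα hα1 h𝒟 mX mξ hX hXi hξ hξi hXξ hZ hd
  have hexc : ∀ D ∈ 𝒟, Integrable (excess (fun d => proj φ f d t) (V P Z) Z D) P ∧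
      ∫ ω, excess (fun d => proj φ f d t) (V P Z) Z D ω ∂P ≤
        (1056 + 675 * (720 * 388 ^ 6)) * (4 * φo ^ 2 / (n ^ 2 * α ^ 2)) := fun D hD => by
    obtain ⟨M, q, h⟩ := hmodel D hD
    obtain ⟨k1, k2⟩ := IsNoisyMean.integral_excess_le (F := fun d => proj φ f d t) h
    have hDn : D ≤ n := by
      have h1 := (le_max_right _ _).trans (hdn D hD)
      rw [le_div_iff₀ (by exact_mod_cast h𝒟 D hD), one_mul] at h1
      exact_mod_cast h1
    exact ⟨k1, k2.trans (mul_le_mul_of_nonneg_left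
      (noise_scale_sq_le (by linarith) hα hn hDn hcard) (by norm_num))⟩
  have hsum : ∫ ω, ∑ D ∈ 𝒟, excess (fun d => proj φ f d t) (V P Z) Z D ω ∂P ≤
      (1056 + 675 * (720 * 388 ^ 6)) * (4 * φo ^ 2 / (n * α ^ 2)) := by
    rw [integral_finsetSum _ fun D hD => (hexc D hD).1]
    refine (Finset.sum_le_card_nsmul _ _ _ fun D hD => (hexc D hD).2).trans ?_
    rw [nsmul_eq_mul]
    refine (mul_le_mul_of_nonneg_right (Nat.cast_le.2 hcard : (𝒟.card : ℝ) ≤ n)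
      (by positivity)).trans (le_of_eq ?_)
    field_simp
  have key : ∀ d ∈ 𝒟, ∫⁻ ω, ENNReal.ofReal (|fHat Z (dHat ω) ω - f t| ^ 2) ∂P ≤
      16 * (biasSq φ f t d + ENNReal.ofReal (V P Z d)) +
        ENNReal.ofReal (36 * (1056 + 675 * (720 * 388 ^ 6)) * φo ^ 2 / (n * α ^ 2)) :=
      fun d hd => by
    -- A dimension with infinite bias gives a trivial bound; otherwise the argument runs in the
    -- reals.
    by_cases hfin : biasSq φ f t d = ⊤
    · simp [hfin, ENNReal.mul_top]
    obtain ⟨M, q, h⟩ := hmodel d hd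
    set B := (biasSq φ f t d).toReal with hBd
    have hB0 : 0 ≤ B := ENNReal.toReal_nonneg
    have hle : ∀ ω, |fHat Z (dHat ω) ω - f t| ^ 2 ≤
        16 * B + 9 * ∑ D ∈ 𝒟, excess (fun d => proj φ f d t) (V P Z) Z D ω +
          8 / 3 * VHat Z d ω + 3 * V P Z d := fun ω =>
      sq_error_selector_le (F := fun d => proj φ f d t) (v := V P Z) hsel hd ω
        (fun D hD => sq_le_toReal_biasSq hD hfin) h.V_nonneg
    have i1 : Integrable (fun ω => ∑ D ∈ 𝒟, excess (fun d => proj φ f d t) (V P Z) Z D ω) P :=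
      integrable_finsetSum _ fun D hD => (hexc D hD).1
    have i2 : Integrable (fun ω => 16 * B +
        9 * ∑ D ∈ 𝒟, excess (fun d => proj φ f d t) (V P Z) Z D ω) P :=
      (integrable_const _).add (i1.const_mul 9)
    have i3 : Integrable (fun ω => 16 * B +
        9 * ∑ D ∈ 𝒟, excess (fun d => proj φ f d t) (V P Z) Z D ω + 8 / 3 * VHat Z d ω) P :=
      i2.add (h.integrable_VHat.const_mul _)
    have i4 : Integrable (fun ω => 16 * B +
        9 * ∑ D ∈ 𝒟, excess (fun d => proj φ f d t) (V P Z) Z D ω + 8 / 3 * VHat Z d ω +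
          3 * V P Z d) P :=
      i3.add (integrable_const _)
    refine (lintegral_mono fun ω => ENNReal.ofReal_le_ofReal (hle ω)).trans ?_
    rw [← ofReal_integral_eq_lintegral_ofReal i4
      (Filter.Eventually.of_forall fun ω => (by positivity : (0 : ℝ) ≤ _).trans (hle ω)),
      integral_add i3 (integrable_const _), integral_add i2 (h.integrable_VHat.const_mul _),
      integral_add (integrable_const _) (i1.const_mul 9), integral_const_mul 9,
      integral_const_mul (8 / 3) (VHat Z d)]
    simp only [integral_const, probReal_univ, smul_eq_mul, one_mul]
    have hreal : 16 * B + 9 * ∫ ω, ∑ D ∈ 𝒟, excess (fun d => proj φ f d t) (V P Z) Z D ω ∂P +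
        8 / 3 * ∫ ω, VHat Z d ω ∂P + 3 * V P Z d ≤
        16 * (B + V P Z d) +
          36 * (1056 + 675 * (720 * 388 ^ 6)) * φo ^ 2 / (n * α ^ 2) := by
      have h1 := h.integral_VHat_le
      have h2 := h.V_nonneg
      have h3 : 36 * (1056 + 675 * (720 * 388 ^ 6)) * φo ^ 2 / (n * α ^ 2) =
          9 * ((1056 + 675 * (720 * 388 ^ 6)) * (4 * φo ^ 2 / (n * α ^ 2))) := by
        ring
      rw [h3]
      linarith
    refine (ENNReal.ofReal_le_ofReal hreal).trans (le_of_eq ?_)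
    rw [ENNReal.ofReal_add (mul_nonneg (by norm_num) (add_nonneg hB0 h.V_nonneg)) (by positivity),
      ENNReal.ofReal_mul (by norm_num), ENNReal.ofReal_add hB0 h.V_nonneg, hBd,
      ENNReal.ofReal_toReal hfin]
    norm_num
  obtain ⟨d, hd, hmin⟩ := 𝒟.exists_mem_eq_inf hne
    fun d => biasSq φ f t d + ENNReal.ofReal (V P Z d)
  rw [← Finset.inf_eq_iInf, hmin]
  exact key d hd
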